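/- Let $K\ge 1$, $m\ge 0$ be integers and, for $i\in[m]=\{1,\dots,m\}$, let $\mathbf p_i=(p_{1i},\dots,p_{Ki})$ be random vectors in $[0,1]^K$ on a common probability space. Let $\theta_{ki}\in\{0,1\}$, where $\theta_{ki}=0$ means that the hypothesis tested by $p_{ki}$ is null, and let $\mathcal S_{0i}=\{k:\theta_{ki}=0\}$. For $\kappa\in\{1,\dots,K\}$ put $\mathcal H_0^{\kappa,\mathrm{partial}}=\{i\in[m]:|\mathcal S_{0i}|\ge\kappa\}$; for $\kappa=1$ this is the composite null set $\mathcal H_0=\{i:\theta_{ki}=0\text{ for some }k\}$. The vector $\mathbf p_i$ is called conditionally mirror conservative if for every $k\in\mathcal S_{0i}$, with $\mathbf p_{-k,i}$ the vector $\mathbf p_i$ without its $k$-th component, for almost every $\mathbf t$ (with respect to the law of $\mathbf p_{-k,i}$) and all $0\le a_1\le a_2\le 1/2$, $$\mathbb P(p_{ki}\in[a_1,a_2]\mid \mathbf p_{-k,i}=\mathbf t)\le \mathbb P(p_{ki}\in[1-a_2,1-a_1]\mid \mathbf p_{-k,i}=\mathbf t).$$ **Joint Mirror procedure.** For $\mathcal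 R\subseteq[0,1/2)^K$ and $k=1,\dots,K$ let $\mathcal A^k(\mathcal R)=\{(t_1,\dots,t_{k-1},1-t_k,t_{k+1},\dots,t_K):\mathbf t\in\mathcal R\}$. Let $\mathcal R_{-1}=[0,1/2)^K$, and let $\mathcal R_0,\mathcal R_1,\dots$ be random regions. For $t\ge -1$ put $$R_t=\sum_{i=1}^m\mathbf 1\{\mathbf p_i\in\mathcal R_t\},\qquad A_t=\sum_{k=1}^K\sum_{i=1}^m\mathbf 1\{\mathbf p_i\in\mathcal A^k(\mathcal R_t)\},\qquad \widehat{\mathrm{FDP}}_t=\frac{1+A_t}{R_t\vee 1},$$ $$\mathcal M_t=\Big\{i:\mathbf p_i\in\mathcal R_t\cup\bigcup_{k=1}^K\mathcal A^k(\mathcal R_t)\Big\},\qquad \mathcal U_t=[m]\setminus\mathcal M_t,$$ and let $\tilde{\mathbf p}_{t,i}=(\min\{1-p_{ki},p_{ki}\})_{k=1}^K$ if $i\in\mathcal M_t$ and $\tilde{\mathbf p}_{t,i}=\mathbf p_i$ if $i\in\mathcal U_t$. Let $\mathcal F_t$ be the $\sigma$-field generated by $(\tilde{\mathbf p}_{t,i})_{i=1}^m$,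 $A_t$, $R_t$, $\mathcal M_t$ and $\mathcal U_t$. The regions are required to satisfy, for all $t\ge-1$, $\mathcal R_{t+1}\subseteq\mathcal R_t$ (shrinkage) and that $\mathcal R_{t+1}$ is $\mathcal F_t$-measurable, i.e. $\{(\omega,\mathbf x):\mathbf x\in\mathcal R_{t+1}(\omega)\}$ belongs to the product of $\mathcal F_t$ and the Borel $\sigma$-field of $\mathbb R^K$ (partial masking). Given a target level $q\in(0,1)$, the procedure stops at the first $t\ge 0$ at which $\widehat{\mathrm{FDP}}_t\le q$ or $R_t=0$, and outputs $\widehat{\mathcal S}=\{i:\mathbf p_i\in\mathcal R_t\}$ for this $t$ (and $\widehat{\mathcal S}=\emptyset$ if it never stops). **Theorem (finite sample FDR control).** Let $\kappa\in\{1,\dots,K\}$ and $q\in(0,1)$. Suppose that the vectors $\{\mathbf p_i\}_{i\in\mathcal H_0^{\kappa,\mathrm{partial}}}$ are mutually independent, that the family of these vectors is independent of the family $\{\mathbf p_i\}_{i\in[m]\setminus\mathcal H_0^{\kappa,\mathrm{partial}}}$, and that $\mathbf p_i$ is conditionally mirror conservative for every $i\in\mathcal H_0^{\kappa,\mathrm{partial}}$.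 Then every Joint Mirror procedure as above satisfies $$\mathrm{FDR}:=\mathbb E\left\{\frac{|\widehat{\mathcal S}\cap\mathcal H_0^{\kappa,\mathrm{partial}}|}{|\widehat{\mathcal S}|\vee 1}\right\}\le\frac q\kappa,\qquad\text{equivalently}\qquad \kappa\,\mathrm{FDR}\le q.$$ In particular, for $\kappa=1$ (the composite null $\mathcal H_0$) the procedure has $\mathrm{FDR}\le q$. -/

import Mathlib

open MeasureTheory ProbabilityTheory

namespace JointMirror

noncomputable section

/-- The coordinates of `x` other than the `k`-th one. -/
def dropCoord {K : ℕ} (k : Fin K) (x : Fin K → ℝ) : {j : Fin K // j ≠ k} → ℝ :=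
  fun j => x j

/-- The `k`-th component of a random vector with law `ν` is conditionally mirror conservative:
given the other components, `[a₁, a₂]` is at most as likely as its mirror image
`[1 - a₂, 1 - a₁]`, for all `0 ≤ a₁ ≤ a₂ ≤ 1/2`. The conditional law is Mathlib's regular
conditional distribution, which is determined up to null sets of the law of the other
components. -/
def MirrorConservativeAt {K : ℕ} (ν : Measure (Fin K → ℝ)) [IsFiniteMeasure ν] (k : Fin K) :
    Prop :=
  ∀ᵐ t ∂(ν.map (dropCoord k)), ∀ a₁ a₂ : ℝ, 0 ≤ a₁ → a₁ ≤ a₂ → a₂ ≤ 1 / 2 →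
    condDistrib (fun x : Fin K → ℝ => x k) (dropCoord k) ν t (Set.Icc a₁ a₂) ≤
      condDistrib (fun x : Fin K → ℝ => x k) (dropCoord k) ν t (Set.Icc (1 - a₂) (1 - a₁))

/-- A law on `[0,1]^K` with hypothesis indicators `θ` (`0` for null, `1` for alternative) is
conditionally mirror conservative if all its null components are. -/
def CondMirrorConservative {K : ℕ} (θ : Fin K → Fin 2) (ν : Measure (Fin K → ℝ))
    [IsFiniteMeasure ν] : Prop :=
  ∀ k, θ k = 0 → MirrorConservativeAt ν k

/-- The null components of a feature. -/
def nullComponents {K : ℕ} (θ : Fin K → Fin 2) : Finset (Fin K) :=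
  Finset.univ.filter (fun k => θ k = 0)

/-- The partial conjunction null set: features with at least `κ` null components. -/
def partialNull {m K : ℕ} (θ : Fin m → Fin K → Fin 2) (κ : ℕ) : Finset (Fin m) :=
  Finset.univ.filter (fun i => κ ≤ (nullComponents (θ i)).card)

/-- The composite null set: features with a null component. -/
def compositeNull {m K : ℕ} (θ : Fin m → Fin K → Fin 2) : Finset (Fin m) :=
  Finset.univ.filter (fun i => ∃ k, θ i k = 0)

/-- The rejection side `[0,1/2)^K`. -/
def rejectionSide (K : ℕ) : Set (Fin K → ℝ) :=
  {x | ∀ k, 0 ≤ x k ∧ x k < 1 / 2}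

/-- The `k`-th mirror region of a rejection region `S`. -/
def mirror {K : ℕ} (k : Fin K) (S : Set (Fin K → ℝ)) : Set (Fin K → ℝ) :=
  (fun t => Function.update t k (1 - t k)) '' S

/-- The coordinatewise minimum of `1 - t` and `t`. -/
def proj {K : ℕ} (t : Fin K → ℝ) : Fin K → ℝ :=
  fun k => min (1 - t k) (t k)

section Regions

variable {Ω : Type*} {m K : ℕ}

open scoped Classical in
/-- The number of rejections of a random region `S`. -/
def numRej (p : Fin m → Ω → Fin K → ℝ) (S : Ω → Set (Fin K → ℝ)) (ω : Ω) : ℕ :=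
  ∑ i : Fin m, if p i ω ∈ S ω then 1 else 0

open scoped Classical in
/-- The number of controls of a random region `S`. -/
def numCtrl (p : Fin m → Ω → Fin K → ℝ) (S : Ω → Set (Fin K → ℝ)) (ω : Ω) : ℕ :=
  ∑ k : Fin K, ∑ i : Fin m, if p i ω ∈ mirror k (S ω) then 1 else 0

/-- The estimated false discovery proportion `(1 + A) / (R ∨ 1)`. -/
def fdpHat (p : Fin m → Ω → Fin K → ℝ) (S : Ω → Set (Fin K → ℝ)) (ω : Ω) : ℝ :=
  (1 + (numCtrl p S ω : ℝ)) / max (numRej p S ω : ℝ) 1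

/-- The masked features: those in the rejection region or in one of its mirror regions. -/
def maskedSet (p : Fin m → Ω → Fin K → ℝ) (S : Ω → Set (Fin K → ℝ)) (ω : Ω) : Set (Fin m) :=
  {i | p i ω ∈ (⋃ k, mirror k (S ω)) ∪ S ω}

/-- The unmasked features. -/
def unmaskedSet (p : Fin m → Ω → Fin K → ℝ) (S : Ω → Set (Fin K → ℝ)) (ω : Ω) : Set (Fin m) :=
  (maskedSet p S ω)ᶜ

open scoped Classical in
/-- The masked p-value vectors. -/
def maskedP (p : Fin m → Ω → Fin K → ℝ) (S : Ω → Set (Fin K → ℝ)) (ω : Ω) :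
    Fin m → Fin K → ℝ :=
  fun i => if i ∈ maskedSet p S ω then proj (p i ω) else p i ω

/-- The sigma-field of the information available when the current region is `S`: it is generated
by the masked p-value vectors, the numbers of controls and rejections, and the masked and
unmasked sets (the last four are discrete). -/
@[reducible] def info (p : Fin m → Ω → Fin K → ℝ) (S : Ω → Set (Fin K → ℝ)) : MeasurableSpace Ω :=
  MeasurableSpace.comap (maskedP p S) inferInstance ⊔
    MeasurableSpace.comap (numCtrl p S) ⊤ ⊔
    MeasurableSpace.comap (numRej p S) ⊤ ⊔
    MeasurableSpace.comap (maskedSet p S) ⊤ ⊔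
    MeasurableSpace.comap (unmaskedSet p S) ⊤

/-- A random region `S` is measurable with respect to a sigma-field `F` on `Ω`: its graph
`{(ω, x) | x ∈ S ω}` belongs to the product of `F` and the Borel sigma-field. -/
def RegionMeasurable (F : MeasurableSpace Ω) (S : Ω → Set (Fin K → ℝ)) : Prop :=
  MeasurableSet[F.prod (inferInstance : MeasurableSpace (Fin K → ℝ))]
    {z : Ω × (Fin K → ℝ) | z.2 ∈ S z.1}

/-- The sequence of rejection regions `R 0, R 1, …` obeys the shrinkage and the partial masking
principles, with the rejection side as the region that precedes `R 0`. -/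
structure IsJMRegions (p : Fin m → Ω → Fin K → ℝ) (R : ℕ → Ω → Set (Fin K → ℝ)) : Prop where
  zero_subset : ∀ ω, R 0 ω ⊆ rejectionSide K
  zero_measurable : RegionMeasurable (info p (fun _ => rejectionSide K)) (R 0)
  succ_subset : ∀ t ω, R (t + 1) ω ⊆ R t ω
  succ_measurable : ∀ t, RegionMeasurable (info p (R t)) (R (t + 1))

/-- The condition of the while loop of the procedure at step `t`. -/
def Continues (q : ℝ) (p : Fin m → Ω → Fin K → ℝ) (R : ℕ → Ω → Set (Fin K → ℝ)) (t : ℕ)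
    (ω : Ω) : Prop :=
  q < fdpHat p (R t) ω ∧ 0 < numRej p (R t) ω

/-- The procedure stops at step `t`, the first step at which the loop condition fails. -/
def StopsAt (q : ℝ) (p : Fin m → Ω → Fin K → ℝ) (R : ℕ → Ω → Set (Fin K → ℝ)) (t : ℕ)
    (ω : Ω) : Prop :=
  ¬ Continues q p R t ω ∧ ∀ s < t, Continues q p R s ω

open scoped Classical in
/-- The set of discoveries of the procedure: the features whose p-value vector lies in the region
at which the procedure stops. It is empty if the procedure never stops. -/
def discoveries (q : ℝ) (p : Fin m → Ω → Fin K → ℝ) (R : ℕ → Ω → Set (Fin K → ℝ)) (ω : Ω) :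
    Finset (Fin m) :=
  Finset.univ.filter (fun i => ∃ t, StopsAt q p R t ω ∧ p i ω ∈ R t ω)

/-- The false discovery proportion of a set `D` of discoveries for the null set `H`. -/
def fdp (H D : Finset (Fin m)) : ℝ :=
  ((D ∩ H).card : ℝ) / max (D.card : ℝ) 1

/-- The false discovery rate of a random set `D` of discoveries for the null set `H`. -/
def fdr [MeasurableSpace Ω] (μ : Measure Ω) (H : Finset (Fin m)) (D : Ω → Finset (Fin m)) : ℝ :=
  ∫ ω, fdp H (D ω) ∂μ

end Regions

end

end JointMirror

/-!
The proof needs neither a martingale nor a conditional law given all masked values; it changes one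
vector at a time. Write `A` for the number of controls at the stopping time and give the `i`-th
vector the weight `1 / (1 + A)` if it is rejected and `0` otherwise (`weight`). Since the estimated
false discovery proportion is at most `q` at the stopping time, the false discovery proportion is
at most `q` times the sum of the weights of the null vectors (`ofReal_fdp_le_sum_weight`). It
remains to show that `κ` times the expectation of this sum is at most one
(`mul_sum_lintegral_weight_le_one`).

Let `k` be a null component of the null vector `i`. The weight of `i` vanishes unless the vector
lies on the rejection side. As the vector is independent of all others (`indepFun_update`) and
conditionally mirror conservative, the expected weight of `i` does not decrease when the data `x`
is replaced by `flipAt i k x`, in which the `k`-th coordinate of the `i`-th vector is reflected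
(`lintegral_le_lintegral_flipAt`). A null vector has at least `κ` null components, so it suffices
that, for any fixed data, the weights of `i` at `flipAt i k x` sum to at most one over all pairs
`(i, k)` (`sum_weight_flipAt_le_one`). Suppose that the weights of `(i, k)` and `(j, l)` with
`i ≠ j` are nonzero. The two modified data sets differ only in which of the vectors `i` and `j` is
in the rejection region and which one is in a mirror region. Partial masking hides this, as the
numbers of rejections and controls agree; hence both modifications run through the same regions and
stop together (`obs_flipAt_eq`, `stopsAt_flipAt_eq`). So if `N` of the weights are nonzero, each of
them counts the other `N - 1` vectors as controls, and is at most `1 / N`.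

For this comparison the procedure has to be run on data that the probability space need not
contain. Measurability with respect to the masked information makes each region a measurable
function of the masked observation, which turns the procedure into a measurable function of the
data (`IsJMRegions.exists_ruleRegion`).
-/

namespace JointMirror

/-! ### Comparing measures on the line through closed intervals -/

/-- The increment of distribution functions `ν (Iic x) - μ (Iic x)` is a Stieltjes function, and
the measure it defines is `ν - μ`. -/
theorem measure_le_of_forall_Icc_le {μ ν : Measure ℝ} [IsFiniteMeasure μ] [IsFiniteMeasure ν]
    (h : ∀ a b, μ (Set.Icc a b) ≤ ν (Set.Icc a b)) : μ ≤ ν := by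
  have hIoc : ∀ a b, μ (Set.Ioc a b) ≤ ν (Set.Ioc a b) := by
    intro a b
    have hU : Set.Ioc a b = ⋃ n : ℕ, Set.Icc (a + 1 / ((n : ℝ) + 1)) b := by
      ext x
      simp only [Set.mem_Ioc, Set.mem_iUnion, Set.mem_Icc]
      constructor
      · rintro ⟨h1, h2⟩
        obtain ⟨n, hn⟩ := exists_nat_one_div_lt (sub_pos.2 h1)
        exact ⟨n, by linarith, h2⟩
      · rintro ⟨n, h1, h2⟩
        have : (0 : ℝ) < 1 / ((n : ℝ) + 1) := by positivity
        exact ⟨by linarith, h2⟩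
    have hmono : Monotone fun n : ℕ => Set.Icc (a + 1 / ((n : ℝ) + 1)) b := by
      intro n n' hn
      apply Set.Icc_subset_Icc_left
      gcongr
    rw [hU, hmono.measure_iUnion, hmono.measure_iUnion]
    exact iSup_mono fun n => h _ _
  have hreal : ∀ (ρ : Measure ℝ) [IsFiniteMeasure ρ] (a b : ℝ), a ≤ b →
      ρ.real (Set.Iic b) - ρ.real (Set.Iic a) = ρ.real (Set.Ioc a b) := by
    intro ρ _ a b hab
    rw [← Set.Iic_sdiff_Iic, measureReal_sdiff (Set.Iic_subset_Iic.2 hab) measurableSet_Iic]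
  have hcont : ∀ (ρ : Measure ℝ) [IsFiniteMeasure ρ] (a : ℝ),
      ContinuousWithinAt (fun x => ρ.real (Set.Iic x)) (Set.Ici a) a := by
    intro ρ _ a
    rw [← continuousWithinAt_Ioi_iff_Ici]
    have h1 := tendsto_measure_biInter_gt (μ := ρ) (s := fun x : ℝ => Set.Iic x) (a := a)
      (fun r _ => measurableSet_Iic.nullMeasurableSet)
      (fun i j _ hij => Set.Iic_subset_Iic.2 hij) ⟨a + 1, by linarith, measure_ne_top _ _⟩
    have h2 : (⋂ r, ⋂ (_ : r > a), Set.Iic r) = Set.Iic a := by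
      ext x
      simp only [Set.mem_iInter, Set.mem_Iic]
      exact ⟨fun hx => le_of_forall_gt_imp_ge_of_dense hx, fun hx r hr => hx.trans hr.le⟩
    rw [h2] at h1
    exact (ENNReal.tendsto_toReal (measure_ne_top ρ _)).comp h1
  let g : StieltjesFunction ℝ :=
    { toFun := fun x => ν.real (Set.Iic x) - μ.real (Set.Iic x)
      mono' := by
        intro a b hab
        have h1 := hreal ν a b hab
        have h2 := hreal μ a b hab
        have h3 : μ.real (Set.Ioc a b) ≤ ν.real (Set.Ioc a b) :=
          ENNReal.toReal_mono (measure_ne_top _ _) (hIoc a b)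
        dsimp only
        linarith
      right_continuous' := fun a => (hcont ν a).sub (hcont μ a) }
  have hν : ν = μ + g.measure := by
    apply Measure.ext_of_Ioc
    intro a b hab
    have h1 := hreal ν a b hab.le
    have h2 := hreal μ a b hab.le
    have hg : g b - g a = ν.real (Set.Ioc a b) - μ.real (Set.Ioc a b) := by
      rw [← h1, ← h2]
      change (ν.real (Set.Iic b) - μ.real (Set.Iic b)) -
        (ν.real (Set.Iic a) - μ.real (Set.Iic a)) = _
      ring
    rw [Measure.add_apply, StieltjesFunction.measure_Ioc, hg, Measure.real, Measure.real,
      ENNReal.ofReal_sub _ ENNReal.toReal_nonneg, ENNReal.ofReal_toReal (measure_ne_top _ _),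
      ENNReal.ofReal_toReal (measure_ne_top _ _), add_tsub_cancel_of_le (hIoc a b)]
  rw [hν]
  exact Measure.le_add_right le_rfl

/-! ### Flipping a coordinate -/

/-- The reflection of the `k`-th coordinate about `1/2`. -/
def flip {K : ℕ} (k : Fin K) (t : Fin K → ℝ) : Fin K → ℝ :=
  Function.update t k (1 - t k)

theorem flip_flip {K : ℕ} (k : Fin K) (t : Fin K → ℝ) : flip k (flip k t) = t := by
  simp [flip]

theorem measurable_flip {K : ℕ} (k : Fin K) : Measurable (flip k) := by
  unfold flip
  fun_prop

theorem mem_mirror_iff {K : ℕ} {k : Fin K} {S : Set (Fin K → ℝ)} {x : Fin K → ℝ} :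
    x ∈ mirror k S ↔ flip k x ∈ S := by
  constructor
  · rintro ⟨t, ht, rfl⟩
    change flip k (flip k t) ∈ S
    rwa [flip_flip]
  · intro h
    exact ⟨_, h, flip_flip k x⟩

theorem proj_flip {K : ℕ} (k : Fin K) (t : Fin K → ℝ) : proj (flip k t) = proj t := by
  funext j
  by_cases h : j = k
  · subst h
    simp [proj, flip, min_comm]
  · simp [proj, flip, h]

/-- The mirror regions of the rejection side are disjoint from each other: a vector in the
`k`-th one has its `k`-th coordinate, and no other, above `1/2`. -/
theorem eq_of_flip_mem_rejectionSide {K : ℕ} {k l : Fin K} {x : Fin K → ℝ}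
    (hk : flip k x ∈ rejectionSide K) (hl : flip l x ∈ rejectionSide K) : k = l := by
  by_contra hne
  have h1 := (hk k).2
  have h2 := (hl k).2
  simp only [flip, Function.update_self] at h1
  simp only [flip, Function.update_of_ne hne] at h2
  linarith

theorem flip_notMem_rejectionSide {K : ℕ} {k : Fin K} {x : Fin K → ℝ}
    (hx : x ∈ rejectionSide K) : flip k x ∉ rejectionSide K := by
  intro hk
  have h1 := (hk k).2
  have h2 := (hx k).2
  simp only [flip, Function.update_self] at h1
  linarith

theorem measurableSet_rejectionSide (K : ℕ) : MeasurableSet (rejectionSide K) := by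
  have : rejectionSide K = ⋂ k, ({x | 0 ≤ x k} ∩ {x | x k < 1 / 2}) := by
    ext x; simp [rejectionSide]
  rw [this]
  refine MeasurableSet.iInter fun k => MeasurableSet.inter ?_ ?_
  · exact measurableSet_le measurable_const (measurable_pi_apply k)
  · exact measurableSet_lt (measurable_pi_apply k) measurable_const

/-- Conditional mirror conservativeness extends from intervals to integrals of functions
supported on the rejection side. -/
theorem lintegral_le_lintegral_flip {K : ℕ} {ν : Measure (Fin K → ℝ)} [IsFiniteMeasure ν]
    {k : Fin K} (hν : MirrorConservativeAt ν k) {f : (Fin K → ℝ) → ENNReal} (hf : Measurable f)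
    (hf0 : ∀ x ∉ rejectionSide K, f x = 0) :
    ∫⁻ x, f x ∂ν ≤ ∫⁻ x, f (flip k x) ∂ν := by
  have hdrop : Measurable (dropCoord k : (Fin K → ℝ) → _) := by unfold dropCoord; fun_prop
  have heval : Measurable (fun x : Fin K → ℝ => x k) := measurable_pi_apply k
  set c := condDistrib (fun x : Fin K → ℝ => x k) (dropCoord k) ν with hc
  let glue : ({j : Fin K // j ≠ k} → ℝ) × ℝ → Fin K → ℝ :=
    fun z j => if h : j = k then z.2 else z.1 ⟨j, h⟩
  have hglue : Measurable glue := by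
    refine measurable_pi_lambda _ fun j => ?_
    by_cases h : j = k
    · simpa [glue, h] using measurable_snd
    · simp only [glue, h, dite_false]
      fun_prop
  have hglue_split : ∀ x : Fin K → ℝ, glue (dropCoord k x, x k) = x := by
    intro x
    funext j
    by_cases h : j = k <;> simp [glue, dropCoord, h]
  have hflip_glue : ∀ t a, flip k (glue (t, a)) = glue (t, 1 - a) := by
    intro t a
    funext j
    by_cases h : j = k
    · subst h; simp [flip, glue]
    · simp [flip, glue, h]
  have hdis : ∀ g : (Fin K → ℝ) → ENNReal, Measurable g →
      ∫⁻ x, g x ∂ν = ∫⁻ t, ∫⁻ a, g (glue (t, a)) ∂(c t) ∂(ν.map (dropCoord k)) := by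
    intro g hg
    have hgm : Measurable fun z => g (glue z) := hg.comp hglue
    rw [← Measure.lintegral_compProd hgm, hc, compProd_map_condDistrib heval.aemeasurable,
      lintegral_map hgm (hdrop.prodMk heval)]
    simp [hglue_split]
  rw [hdis f hf, hdis (fun x => f (flip k x)) (hf.comp (measurable_flip k))]
  apply lintegral_mono_ae
  filter_upwards [hν] with t ht
  simp only [hflip_glue]
  set φ : ℝ → ENNReal := fun a => f (glue (t, a)) with hφ
  have hφm : Measurable φ := hf.comp (hglue.comp measurable_prodMk_left)
  have hφ0 : ∀ a ∉ Set.Icc (0 : ℝ) (1 / 2), φ a = 0 := by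
    intro a ha
    apply hf0
    intro hx
    apply ha
    have := hx k
    simp only [glue, dite_true] at this
    exact ⟨this.1, this.2.le⟩
  have hrefl : Measurable fun a : ℝ => 1 - a := by fun_prop
  have hle : (c t).restrict (Set.Icc 0 (1 / 2)) ≤
      ((c t).map fun a => 1 - a).restrict (Set.Icc 0 (1 / 2)) := by
    apply measure_le_of_forall_Icc_le
    intro a b
    rw [Measure.restrict_apply measurableSet_Icc, Measure.restrict_apply measurableSet_Icc,
      Set.Icc_inter_Icc, Measure.map_apply hrefl measurableSet_Icc, Set.preimage_const_sub_Icc]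
    by_cases hab : max a 0 ≤ min b (1 / 2)
    · exact ht _ _ (le_max_right _ _) hab (min_le_right _ _)
    · rw [Set.Icc_eq_empty hab]
      simp
  calc ∫⁻ a, φ a ∂(c t) = ∫⁻ a in Set.Icc 0 (1 / 2), φ a ∂(c t) := by
        rw [← lintegral_indicator measurableSet_Icc]
        congr 1
        funext a
        by_cases ha : a ∈ Set.Icc (0 : ℝ) (1 / 2)
        · rw [Set.indicator_of_mem ha]
        · rw [Set.indicator_of_notMem ha, hφ0 a ha]
    _ ≤ ∫⁻ a in Set.Icc 0 (1 / 2), φ a ∂((c t).map fun a => 1 - a) := lintegral_mono' hle le_rfl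
    _ ≤ ∫⁻ a, φ a ∂((c t).map fun a => 1 - a) := setLIntegral_le_lintegral _ _
    _ = ∫⁻ a, φ (1 - a) ∂(c t) := lintegral_map hφm hrefl

/-! ### Independence of one null vector from all the others -/

/-- If `(X, Y)` is independent of `Z` and `X` of `Y`, then `X` is independent of `(Y, Z)`. -/
theorem indepFun_prodMk_of_indepFun {Ω α β γ : Type*} [MeasurableSpace Ω] [MeasurableSpace α]
    [MeasurableSpace β] [MeasurableSpace γ] {μ : Measure Ω} [IsProbabilityMeasure μ]
    {X : Ω → α} {Y : Ω → β} {Z : Ω → γ} (hX : Measurable X) (hY : Measurable Y)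
    (hZ : Measurable Z) (hXY : IndepFun X Y μ)
    (hXYZ : IndepFun (fun ω => (X ω, Y ω)) Z μ) :
    IndepFun X (fun ω => (Y ω, Z ω)) μ := by
  have hpX := Measure.isProbabilityMeasure_map (μ := μ) hX.aemeasurable
  have hpY := Measure.isProbabilityMeasure_map (μ := μ) hY.aemeasurable
  have hpZ := Measure.isProbabilityMeasure_map (μ := μ) hZ.aemeasurable
  have hYZ : IndepFun Y Z μ := hXYZ.comp measurable_snd measurable_id
  rw [indepFun_iff_map_prod_eq_prod_map_map hX.aemeasurable (hY.prodMk hZ).aemeasurable,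
    hYZ.map_prod_eq_prod_map_map hY.aemeasurable hZ.aemeasurable, ← Measure.prodAssoc_prod,
    ← hXY.map_prod_eq_prod_map_map hX.aemeasurable hY.aemeasurable,
    ← hXYZ.map_prod_eq_prod_map_map (hX.prodMk hY).aemeasurable hZ.aemeasurable,
    Measure.map_map (by fun_prop) (by fun_prop)]
  rfl

/-- A member of a mutually independent subfamily, which as a whole is independent of the remaining
vectors, is independent of all other vectors. The other vectors are encoded as the whole family
with the `i`-th entry replaced by `0`. -/
theorem indepFun_update {Ω ι E : Type*} [MeasurableSpace Ω] [Fintype ι] [DecidableEq ι]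
    [MeasurableSpace E] [Zero E] {μ : Measure Ω} [IsProbabilityMeasure μ] {H : Finset ι}
    {X : ι → Ω → E} (hX : ∀ i, Measurable (X i))
    (hind : iIndepFun (fun i : {i // i ∈ H} => X i) μ)
    (hsep : IndepFun (fun ω (i : {i // i ∈ H}) => X i ω) (fun ω (i : {i // i ∉ H}) => X i ω) μ)
    {i : ι} (hi : i ∈ H) :
    IndepFun (X i) (fun ω => Function.update (fun j => X j ω) i 0) μ := by
  let T : Finset {j // j ∈ H} := Finset.univ.erase ⟨i, hi⟩
  have h1 := hind.indepFun_finset {⟨i, hi⟩} T (by simp [T]) (fun j => hX j)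
  have h2 : IndepFun (X i) (fun ω (j : T) => X j ω) μ :=
    h1.comp (measurable_pi_apply (⟨⟨i, hi⟩, Finset.mem_singleton_self _⟩ :
      ({⟨i, hi⟩} : Finset {j // j ∈ H}))) measurable_id
  have h3 : IndepFun (fun ω => (X i ω, fun j : T => X j ω)) (fun ω (j : {j // j ∉ H}) => X j ω) μ :=
    hsep.comp (φ := fun z => (z ⟨i, hi⟩, fun j : T => z j)) (ψ := id) (by fun_prop) measurable_id
  have h4 := indepFun_prodMk_of_indepFun (hX i) (by fun_prop) (by fun_prop) h2 h3
  let ψ : (T → E) × ({j // j ∉ H} → E) → ι → E := fun z j =>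
    if hj : j = i then 0 else
      if hjH : j ∈ H then z.1 ⟨⟨j, hjH⟩, by simp [T, hj]⟩ else z.2 ⟨j, hjH⟩
  have hψ : Measurable ψ := by
    refine measurable_pi_lambda _ fun j => ?_
    by_cases hj : j = i
    · simp only [ψ, hj, dite_true]
      exact measurable_const
    · by_cases hjH : j ∈ H
      · simp only [ψ, hj, hjH, dite_true, dite_false]
        fun_prop
      · simp only [ψ, hj, hjH, dite_false]
        fun_prop
  have h5 := h4.comp measurable_id hψ
  have h6 : (fun ω => Function.update (fun j => X j ω) i 0) =
      ψ ∘ fun ω => (fun j : T => X j ω, fun j : {j // j ∉ H} => X j ω) := by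
    funext ω j
    by_cases hj : j = i
    · subst hj; simp [ψ]
    · by_cases hjH : j ∈ H <;> simp [ψ, hj, hjH]
  rw [h6]
  exact h5

/-- Reflecting the `k`-th coordinate of the `i`-th vector. -/
def flipAt {m K : ℕ} (i : Fin m) (k : Fin K) (x : Fin m → Fin K → ℝ) : Fin m → Fin K → ℝ :=
  Function.update x i (flip k (x i))

/-- Moving a null vector from the rejection side to a null mirror side does not decrease
expectations. -/
theorem lintegral_le_lintegral_flipAt {Ω : Type*} [MeasurableSpace Ω] {μ : Measure Ω}
    [IsProbabilityMeasure μ] {m K : ℕ} {p : Fin m → Ω → Fin K → ℝ} (hp : ∀ i, Measurable (p i))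
    {i : Fin m} {k : Fin K}
    (hind : IndepFun (p i) (fun ω => Function.update (fun j => p j ω) i 0) μ)
    (hmir : MirrorConservativeAt (μ.map (p i)) k)
    {f : (Fin m → Fin K → ℝ) → ENNReal} (hf : Measurable f)
    (hf0 : ∀ x, x i ∉ rejectionSide K → f x = 0) :
    ∫⁻ ω, f (fun j => p j ω) ∂μ ≤ ∫⁻ ω, f (flipAt i k (fun j => p j ω)) ∂μ := by
  have hY : Measurable fun ω => Function.update (fun j => p j ω) i 0 := by
    refine measurable_pi_lambda _ fun j => ?_
    by_cases h : j = i
    · subst h; simp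
    · simpa [h] using hp j
  have hu : Measurable fun z : (Fin K → ℝ) × (Fin m → Fin K → ℝ) =>
      Function.update z.2 i z.1 := by
    refine measurable_pi_lambda _ fun j => ?_
    by_cases h : j = i
    · subst h; simpa using measurable_fst
    · simp only [Function.update_of_ne h]; fun_prop
  have hdis : ∀ g : (Fin K → ℝ) → (Fin K → ℝ), Measurable g →
      ∫⁻ ω, f (Function.update (fun j => p j ω) i (g (p i ω))) ∂μ =
        ∫⁻ y, ∫⁻ a, f (Function.update y i (g a)) ∂(μ.map (p i))
          ∂(μ.map fun ω => Function.update (fun j => p j ω) i 0) := by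
    intro g hg
    have hm : Measurable fun z : (Fin K → ℝ) × (Fin m → Fin K → ℝ) =>
        f (Function.update z.2 i (g z.1)) :=
      hf.comp (hu.comp ((hg.comp measurable_fst).prodMk measurable_snd))
    rw [← lintegral_prod_symm' _ hm, ← hind.map_prod_eq_prod_map_map (hp i).aemeasurable
      hY.aemeasurable, lintegral_map hm ((hp i).prodMk hY)]
    simp
  have h1 := hdis id measurable_id
  have h2 := hdis (flip k) (measurable_flip k)
  simp only [id, Function.update_eq_self] at h1
  unfold flipAt
  rw [h2]
  refine (le_of_eq ?_).trans (lintegral_mono fun y => lintegral_le_lintegral_flip hmir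
    (f := fun a => f (Function.update y i a)) (hf.comp (hu.comp measurable_prodMk_right)) ?_)
  · exact h1
  · intro a ha
    exact hf0 _ (by simpa using ha)

/-! ### The procedure as a function of the data -/

/-- The coordinate process on the space of data: the `i`-th vector of the data `x`. -/
def coordP {m K : ℕ} : Fin m → (Fin m → Fin K → ℝ) → Fin K → ℝ :=
  fun i x => x i

/-- The values of the observation that generates `info`. The unmasked set is left out, being the
complement of the masked set. -/
abbrev Obs (m K : ℕ) : Type :=
  (Fin m → Fin K → ℝ) × ℕ × ℕ × Set (Fin m)

/-- The observation that generates `info`. -/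
noncomputable def obs {Ω : Type*} {m K : ℕ} (p : Fin m → Ω → Fin K → ℝ)
    (S : Ω → Set (Fin K → ℝ)) (ω : Ω) : Obs m K :=
  (maskedP p S ω, numCtrl p S ω, numRej p S ω, maskedSet p S ω)

theorem info_le_comap_obs {Ω : Type*} {m K : ℕ} (p : Fin m → Ω → Fin K → ℝ)
    (S : Ω → Set (Fin K → ℝ)) :
    info p S ≤ MeasurableSpace.comap (obs p S) inferInstance := by
  have ho : Measurable[MeasurableSpace.comap (obs p S) inferInstance] (obs p S) :=
    comap_measurable _
  have hset : ∀ g : Set (Fin m) → Set (Fin m), @Measurable _ _ inferInstance ⊤ g :=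
    fun g s _ => MeasurableSet.of_discrete
  refine sup_le (sup_le (sup_le (sup_le ?_ ?_) ?_) ?_) ?_
  · exact (measurable_fst.comp ho).comap_le
  · exact (measurable_fst.comp (measurable_snd.comp ho)).comap_le
  · exact (measurable_fst.comp (measurable_snd.comp (measurable_snd.comp ho))).comap_le
  · exact ((hset id).comp
      (measurable_snd.comp (measurable_snd.comp (measurable_snd.comp ho)))).comap_le
  · exact ((hset compl).comp
      (measurable_snd.comp (measurable_snd.comp (measurable_snd.comp ho)))).comap_le

/-- A factorization of Doob–Dynkin type: a region measurable with respect to `info p S` is a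
measurable function of the observation. -/
theorem RegionMeasurable.exists_eq {Ω : Type*} {m K : ℕ} {p : Fin m → Ω → Fin K → ℝ}
    {S R : Ω → Set (Fin K → ℝ)} (h : RegionMeasurable (info p S) R) :
    ∃ G : Set (Obs m K × (Fin K → ℝ)), MeasurableSet G ∧
      ∀ ω a, a ∈ R ω ↔ (obs p S ω, a) ∈ G := by
  have hle : (info p S).prod (inferInstance : MeasurableSpace (Fin K → ℝ)) ≤
      MeasurableSpace.comap (Prod.map (obs p S) id) inferInstance := by
    have hm : Measurable[MeasurableSpace.comap
        (Prod.map (obs p S) (id : (Fin K → ℝ) → Fin K → ℝ)) inferInstance]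
        (Prod.map (obs p S) (id : (Fin K → ℝ) → Fin K → ℝ)) := comap_measurable _
    refine sup_le ?_ ?_
    · refine (MeasurableSpace.comap_mono (info_le_comap_obs p S)).trans ?_
      rw [MeasurableSpace.comap_comp]
      exact (measurable_fst.comp hm).comap_le
    · exact (measurable_snd.comp hm).comap_le
  obtain ⟨G, hG, hGe⟩ := hle _ h
  refine ⟨G, hG, fun ω a => ?_⟩
  have := Set.ext_iff.1 hGe (ω, a)
  simpa using this.symm

/-- The regions produced from the data by the update rules `G`: the next region consists of the
points of the current one that the rule accepts, given the current observation. The sequence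
starts with the rejection side, so that its index is one more than that of the procedure. -/
noncomputable def ruleRegion {m K : ℕ} (G : ℕ → Set (Obs m K × (Fin K → ℝ))) :
    ℕ → (Fin m → Fin K → ℝ) → Set (Fin K → ℝ)
  | 0 => fun _ => rejectionSide K
  | t + 1 => fun x =>
      {a | a ∈ ruleRegion G t x ∧ (obs coordP (ruleRegion G t) x, a) ∈ G t}

theorem obs_coordP {Ω : Type*} {m K : ℕ} {p : Fin m → Ω → Fin K → ℝ} {S : Ω → Set (Fin K → ℝ)}
    {S' : (Fin m → Fin K → ℝ) → Set (Fin K → ℝ)} {ω : Ω} (h : S ω = S' (fun i => p i ω)) :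
    obs p S ω = obs coordP S' (fun i => p i ω) := by
  unfold obs maskedP maskedSet numCtrl numRej
  rw [h]
  rfl

theorem IsJMRegions.exists_ruleRegion {Ω : Type*} {m K : ℕ} {p : Fin m → Ω → Fin K → ℝ}
    {R : ℕ → Ω → Set (Fin K → ℝ)} (hR : IsJMRegions p R) :
    ∃ G : ℕ → Set (Obs m K × (Fin K → ℝ)), (∀ t, MeasurableSet (G t)) ∧
      ∀ t ω, R t ω = ruleRegion G (t + 1) (fun i => p i ω) := by
  obtain ⟨G0, hG0, h0⟩ := hR.zero_measurable.exists_eq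
  choose G' hG' h' using fun t => (hR.succ_measurable t).exists_eq
  refine ⟨fun t => Nat.casesOn t G0 G', fun t => by cases t <;> simp [hG0, hG'], fun t => ?_⟩
  induction t with
  | zero =>
    intro ω
    ext a
    simp only [ruleRegion, Set.mem_ofPred_eq]
    rw [h0, obs_coordP (S := fun _ => rejectionSide K) (S' := fun _ => rejectionSide K) rfl]
    refine ⟨fun h => ⟨hR.zero_subset ω ?_, h⟩, fun h => h.2⟩
    rw [h0, obs_coordP (S := fun _ => rejectionSide K) (S' := fun _ => rejectionSide K) rfl]
    exact h
  | succ t ih =>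
    intro ω
    ext a
    rw [ruleRegion, Set.mem_ofPred_eq, ← ih ω, ← obs_coordP (ih ω), ← h']
    exact ⟨fun h => ⟨hR.succ_subset t ω h, h⟩, fun h => h.2⟩

theorem ruleRegion_succ_subset {m K : ℕ} (G : ℕ → Set (Obs m K × (Fin K → ℝ))) (t : ℕ)
    (x : Fin m → Fin K → ℝ) : ruleRegion G (t + 1) x ⊆ ruleRegion G t x :=
  fun _ ha => ha.1

theorem ruleRegion_antitone {m K : ℕ} (G : ℕ → Set (Obs m K × (Fin K → ℝ)))
    (x : Fin m → Fin K → ℝ) : Antitone fun t => ruleRegion G t x :=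
  antitone_nat_of_succ_le fun t => ruleRegion_succ_subset G t x

theorem ruleRegion_subset_rejectionSide {m K : ℕ} (G : ℕ → Set (Obs m K × (Fin K → ℝ))) (t : ℕ)
    (x : Fin m → Fin K → ℝ) : ruleRegion G t x ⊆ rejectionSide K :=
  ruleRegion_antitone G x (Nat.zero_le t)

/-! ### Measurability -/

section Measurability

variable {m K : ℕ} {S : (Fin m → Fin K → ℝ) → Set (Fin K → ℝ)}

theorem measurableSet_mem_region
    (hS : MeasurableSet {z : (Fin m → Fin K → ℝ) × (Fin K → ℝ) | z.2 ∈ S z.1}) (i : Fin m) :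
    MeasurableSet {x : Fin m → Fin K → ℝ | coordP i x ∈ S x} :=
  hS.preimage (measurable_id.prodMk (measurable_pi_apply i))

theorem measurableSet_mem_mirror
    (hS : MeasurableSet {z : (Fin m → Fin K → ℝ) × (Fin K → ℝ) | z.2 ∈ S z.1}) (k : Fin K)
    (i : Fin m) : MeasurableSet {x : Fin m → Fin K → ℝ | coordP i x ∈ mirror k (S x)} := by
  simp only [mem_mirror_iff]
  exact hS.preimage (measurable_id.prodMk ((measurable_flip k).comp (measurable_pi_apply i)))

theorem measurable_numRej
    (hS : MeasurableSet {z : (Fin m → Fin K → ℝ) × (Fin K → ℝ) | z.2 ∈ S z.1}) :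
    Measurable (numRej coordP S) :=
  Finset.measurable_sum _ fun i _ =>
    Measurable.ite (measurableSet_mem_region hS i) measurable_const measurable_const

theorem measurable_numCtrl
    (hS : MeasurableSet {z : (Fin m → Fin K → ℝ) × (Fin K → ℝ) | z.2 ∈ S z.1}) :
    Measurable (numCtrl coordP S) :=
  Finset.measurable_sum _ fun k _ => Finset.measurable_sum _ fun i _ =>
    Measurable.ite (measurableSet_mem_mirror hS k i) measurable_const measurable_const

theorem measurable_obs
    (hS : MeasurableSet {z : (Fin m → Fin K → ℝ) × (Fin K → ℝ) | z.2 ∈ S z.1}) :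
    Measurable (obs coordP S) := by
  have hmask : ∀ i, MeasurableSet {x | i ∈ maskedSet coordP S x} := by
    intro i
    have : {x | i ∈ maskedSet coordP S x} =
        (⋃ k, {x | coordP i x ∈ mirror k (S x)}) ∪ {x | coordP i x ∈ S x} := by
      ext x; simp [maskedSet]
    rw [this]
    exact (MeasurableSet.iUnion fun k => measurableSet_mem_mirror hS k i).union
      (measurableSet_mem_region hS i)
  refine Measurable.prodMk ?_ ((measurable_numCtrl hS).prodMk ((measurable_numRej hS).prodMk ?_))
  · refine measurable_pi_lambda _ fun i => ?_
    refine Measurable.ite (hmask i) ?_ (measurable_pi_apply i)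
    refine measurable_pi_lambda _ fun k => ?_
    simp only [proj, coordP]
    fun_prop
  · rw [measurable_set_iff]
    exact fun i => measurableSet_setOfPred.1 (hmask i)

theorem measurableSet_ruleRegion {G : ℕ → Set (Obs m K × (Fin K → ℝ))}
    (hG : ∀ t, MeasurableSet (G t)) (t : ℕ) :
    MeasurableSet {z : (Fin m → Fin K → ℝ) × (Fin K → ℝ) | z.2 ∈ ruleRegion G t z.1} := by
  induction t with
  | zero => exact (measurableSet_rejectionSide K).preimage measurable_snd
  | succ t ih =>
    exact ih.inter ((hG t).preimage (((measurable_obs ih).comp measurable_fst).prodMk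
      measurable_snd))

theorem measurableSet_stopsAt {q : ℝ} {R : ℕ → (Fin m → Fin K → ℝ) → Set (Fin K → ℝ)}
    (hR : ∀ t, MeasurableSet {z : (Fin m → Fin K → ℝ) × (Fin K → ℝ) | z.2 ∈ R t z.1}) (t : ℕ) :
    MeasurableSet {x | StopsAt q coordP R t x} := by
  have hcast : Measurable (fun n : ℕ => (n : ℝ)) := measurable_from_top
  have hcont : ∀ s, MeasurableSet {x | Continues q coordP R s x} := by
    intro s
    have h1 : Measurable (fdpHat coordP (R s)) :=
      (measurable_const.add (hcast.comp (measurable_numCtrl (hR s)))).div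
        ((hcast.comp (measurable_numRej (hR s))).max measurable_const)
    exact (measurableSet_lt measurable_const h1).inter
      (measurableSet_lt measurable_const (measurable_numRej (hR s)))
  have : {x | StopsAt q coordP R t x} =
      {x | Continues q coordP R t x}ᶜ ∩ ⋂ s, ⋂ (_ : s < t), {x | Continues q coordP R s x} := by
    ext x; simp [StopsAt]
  rw [this]
  exact (hcont t).compl.inter (MeasurableSet.iInter fun s => MeasurableSet.iInter fun _ => hcont s)

theorem measurable_fdp_discoveries (H : Finset (Fin m)) {q : ℝ}
    {R : ℕ → (Fin m → Fin K → ℝ) → Set (Fin K → ℝ)}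
    (hR : ∀ t, MeasurableSet {z : (Fin m → Fin K → ℝ) × (Fin K → ℝ) | z.2 ∈ R t z.1}) :
    Measurable fun x => fdp H (discoveries q coordP R x) := by
  have hD : Measurable fun x => discoveries q coordP R x := by
    rw [measurable_finset_iff]
    intro i
    rw [← measurableSet_setOfPred]
    have : {x | i ∈ discoveries q coordP R x} =
        ⋃ t, {x | StopsAt q coordP R t x} ∩ {x | coordP i x ∈ R t x} := by
      ext x; simp [discoveries]
    rw [this]
    exact MeasurableSet.iUnion fun t =>
      (measurableSet_stopsAt hR t).inter (measurableSet_mem_region (hR t) i)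
  exact (Measurable.of_discrete (f := fdp H)).comp hD

end Measurability

/-! ### Flipped data sets stop together -/

section Combinatorics

variable {m K : ℕ}

theorem numCtrl_eq_card (S : (Fin m → Fin K → ℝ) → Set (Fin K → ℝ)) (x : Fin m → Fin K → ℝ)
    [DecidablePred fun w : Fin m × Fin K => flip w.2 (x w.1) ∈ S x] :
    numCtrl coordP S x =
      (Finset.univ.filter fun w : Fin m × Fin K => flip w.2 (x w.1) ∈ S x).card := by
  classical
  rw [numCtrl, Finset.sum_comm, Finset.card_filter, Fintype.sum_prod_type]
  refine Finset.sum_congr rfl fun i _ => Finset.sum_congr rfl fun k _ => ?_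
  exact if_congr mem_mirror_iff rfl rfl

/-- If two vectors of the data `x` lie in mirror regions of `S`, then moving either of them into
`S` yields the same observation: the masked vectors do not tell which one was moved. -/
theorem obs_flipAt_eq {S : Set (Fin K → ℝ)} (hS : S ⊆ rejectionSide K) {x : Fin m → Fin K → ℝ}
    {i j : Fin m} {k l : Fin K} (hij : i ≠ j) (hi : flip k (x i) ∈ S) (hj : flip l (x j) ∈ S) :
    obs coordP (fun _ => S) (flipAt i k x) = obs coordP (fun _ => S) (flipAt j l x) := by
  classical
  have hyi : flipAt i k x i = flip k (x i) := by simp [flipAt]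
  have hzj : flipAt j l x j = flip l (x j) := by simp [flipAt]
  have hy : ∀ a, a ≠ i → flipAt i k x a = x a := fun a ha => by simp [flipAt, ha]
  have hz : ∀ a, a ≠ j → flipAt j l x a = x a := fun a ha => by simp [flipAt, ha]
  have hin : x i ∉ S := fun h => flip_notMem_rejectionSide (hS h) (hS hi)
  have hjn : x j ∉ S := fun h => flip_notMem_rejectionSide (hS h) (hS hj)
  have hiS : ∀ k', flip k' (x i) ∈ S ↔ k' = k := fun k' =>
    ⟨fun h => eq_of_flip_mem_rejectionSide (hS h) (hS hi), fun h => h ▸ hi⟩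
  have hjS : ∀ k', flip k' (x j) ∈ S ↔ k' = l := fun k' =>
    ⟨fun h => eq_of_flip_mem_rejectionSide (hS h) (hS hj), fun h => h ▸ hj⟩
  have hiS' : ∀ k', flip k' (flip k (x i)) ∉ S := fun k' h =>
    flip_notMem_rejectionSide (hS hi) (hS h)
  have hjS' : ∀ k', flip k' (flip l (x j)) ∉ S := fun k' h =>
    flip_notMem_rejectionSide (hS hj) (hS h)
  have hmask : maskedSet coordP (fun _ => S) (flipAt i k x) =
      maskedSet coordP (fun _ => S) (flipAt j l x) := by
    ext a
    simp only [maskedSet, coordP, Set.mem_ofPred_eq, Set.mem_union, Set.mem_iUnion, mem_mirror_iff]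
    by_cases hai : a = i
    · subst hai
      rw [hyi, hz a hij]
      exact ⟨fun _ => Or.inl ⟨k, hi⟩, fun _ => Or.inr hi⟩
    · by_cases haj : a = j
      · subst haj
        rw [hzj, hy a hai]
        exact ⟨fun _ => Or.inr hj, fun _ => Or.inl ⟨l, hj⟩⟩
      · rw [hy a hai, hz a haj]
  -- The roles of `i` and `j` are interchanged, so the counts are matched by a transposition.
  have hcount : ∀ g : (Fin K → ℝ) → ℕ, g (flip k (x i)) = g (flip l (x j)) → g (x i) = g (x j) →
      ∑ a, g (flipAt i k x a) = ∑ a, g (flipAt j l x a) := by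
    intro g h1 h2
    refine Fintype.sum_equiv (Equiv.swap i j) _ _ fun a => ?_
    by_cases hai : a = i
    · subst hai
      rw [Equiv.swap_apply_left, hyi, hzj, h1]
    · by_cases haj : a = j
      · subst haj
        rw [Equiv.swap_apply_right, hy a hai, hz i hij, h2]
      · rw [Equiv.swap_apply_of_ne_of_ne hai haj, hy a hai, hz a haj]
  have hrej : numRej coordP (fun _ => S) (flipAt i k x) =
      numRej coordP (fun _ => S) (flipAt j l x) :=
    hcount (fun v => if v ∈ S then 1 else 0) (by simp [hi, hj]) (by simp [hin, hjn])
  have hctrl : numCtrl coordP (fun _ => S) (flipAt i k x) =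
      numCtrl coordP (fun _ => S) (flipAt j l x) := by
    unfold numCtrl
    rw [Finset.sum_comm, Finset.sum_comm (s := Finset.univ (α := Fin K))]
    refine hcount (fun v => ∑ k', if v ∈ mirror k' S then 1 else 0) ?_ ?_
    · simp [mem_mirror_iff, hiS', hjS']
    · simp [mem_mirror_iff, hiS, hjS]
  have hmaskP : maskedP coordP (fun _ => S) (flipAt i k x) =
      maskedP coordP (fun _ => S) (flipAt j l x) := by
    funext a
    simp only [maskedP, hmask, coordP]
    by_cases hai : a = i
    · subst hai
      have hmem : a ∈ maskedSet coordP (fun _ => S) (flipAt j l x) := by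
        rw [← hmask]
        exact Or.inr (by simpa [coordP, hyi] using hi)
      rw [if_pos hmem, if_pos hmem, hyi, hz a hij, proj_flip]
    · by_cases haj : a = j
      · subst haj
        have hmem : a ∈ maskedSet coordP (fun _ => S) (flipAt a l x) :=
          Or.inr (by simpa [coordP, hzj] using hj)
        rw [if_pos hmem, if_pos hmem, hzj, hy a hai, proj_flip]
      · rw [hy a hai, hz a haj]
  simp only [obs, hmask, hrej, hctrl, hmaskP]

theorem StopsAt.unique {Ω : Type*} {q : ℝ} {p : Fin m → Ω → Fin K → ℝ}
    {R : ℕ → Ω → Set (Fin K → ℝ)} {ω : Ω} {s t : ℕ} (hs : StopsAt q p R s ω)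
    (ht : StopsAt q p R t ω) : s = t := by
  rcases lt_trichotomy s t with h | h | h
  · exact absurd (ht.2 s h) hs.1
  · exact h
  · exact absurd (hs.2 t h) ht.1

theorem continues_iff_of_obs_eq {q : ℝ} {R : ℕ → (Fin m → Fin K → ℝ) → Set (Fin K → ℝ)} {t : ℕ}
    {y z : Fin m → Fin K → ℝ} (h : obs coordP (R t) y = obs coordP (R t) z) :
    Continues q coordP R t y ↔ Continues q coordP R t z := by
  have h1 : numCtrl coordP (R t) y = numCtrl coordP (R t) z := congrArg (fun o => o.2.1) h
  have h2 : numRej coordP (R t) y = numRej coordP (R t) z := congrArg (fun o => o.2.2.1) h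
  simp only [Continues, fdpHat, h1, h2]

variable {G : ℕ → Set (Obs m K × (Fin K → ℝ))} {q : ℝ} {x : Fin m → Fin K → ℝ} {i j : Fin m}
  {k l : Fin K} {s t : ℕ}

/-- As long as both moved vectors stay in the respective regions, the two modified data sets go
through the same regions. -/
theorem ruleRegion_flipAt_eq (hij : i ≠ j) {u : ℕ}
    (hi : ∀ v < u, flip k (x i) ∈ ruleRegion G v (flipAt i k x))
    (hj : ∀ v < u, flip l (x j) ∈ ruleRegion G v (flipAt j l x)) :
    ruleRegion G u (flipAt i k x) = ruleRegion G u (flipAt j l x) := by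
  induction u with
  | zero => rfl
  | succ u ih =>
    have heq := ih (fun v hv => hi v (hv.trans u.lt_succ_self))
      fun v hv => hj v (hv.trans u.lt_succ_self)
    have hiu := hi u u.lt_succ_self
    have hju := hj u u.lt_succ_self
    rw [← heq] at hju
    have ho := obs_flipAt_eq (ruleRegion_subset_rejectionSide G u (flipAt i k x)) hij hiu hju
    have ho' : obs coordP (ruleRegion G u) (flipAt i k x) =
        obs coordP (ruleRegion G u) (flipAt j l x) := by
      calc _ = _ := ho
        _ = _ := by rw [heq]; rfl
    ext a
    simp only [ruleRegion, Set.mem_ofPred_eq, heq, ho']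

/-- The core of the argument: if, after moving the `i`-th vector to the rejection side, it is
rejected, and likewise for the `j`-th vector, then both modified data sets stop at the same time
and with the same region. -/
theorem stopsAt_flipAt_eq (hij : i ≠ j)
    (hs : StopsAt q coordP (fun t => ruleRegion G (t + 1)) s (flipAt i k x))
    (hi : flip k (x i) ∈ ruleRegion G (s + 1) (flipAt i k x))
    (ht : StopsAt q coordP (fun t => ruleRegion G (t + 1)) t (flipAt j l x))
    (hj : flip l (x j) ∈ ruleRegion G (t + 1) (flipAt j l x)) :
    s = t ∧ ruleRegion G (s + 1) (flipAt i k x) = ruleRegion G (t + 1) (flipAt j l x) := by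
  have hi' : ∀ v, v ≤ s + 1 → flip k (x i) ∈ ruleRegion G v (flipAt i k x) :=
    fun v hv => ruleRegion_antitone G _ hv hi
  have hj' : ∀ v, v ≤ t + 1 → flip l (x j) ∈ ruleRegion G v (flipAt j l x) :=
    fun v hv => ruleRegion_antitone G _ hv hj
  have hreg : ∀ u, u ≤ s → u ≤ t →
      ruleRegion G (u + 1) (flipAt i k x) = ruleRegion G (u + 1) (flipAt j l x) := by
    intro u hus hut
    exact ruleRegion_flipAt_eq hij (fun v hv => hi' v (by omega)) fun v hv => hj' v (by omega)
  have hcont : ∀ u, u ≤ s → u ≤ t →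
      (Continues q coordP (fun t => ruleRegion G (t + 1)) u (flipAt i k x) ↔
        Continues q coordP (fun t => ruleRegion G (t + 1)) u (flipAt j l x)) := by
    intro u hus hut
    have heq := hreg u hus hut
    refine continues_iff_of_obs_eq (R := fun t => ruleRegion G (t + 1)) ?_
    have hju := hj' (u + 1) (by omega)
    rw [← heq] at hju
    calc _ = _ := obs_flipAt_eq (ruleRegion_subset_rejectionSide G (u + 1) (flipAt i k x)) hij
          (hi' (u + 1) (by omega)) hju
      _ = _ := by rw [heq]; rfl
  have hst : s = t := by
    rcases lt_trichotomy s t with h | h | h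
    · exact absurd ((hcont s le_rfl h.le).2 (ht.2 s h)) hs.1
    · exact h
    · exact absurd ((hcont t h.le le_rfl).1 (hs.2 t h)) ht.1
  subst hst
  exact ⟨rfl, hreg s le_rfl le_rfl⟩

end Combinatorics

/-! ### The weight of a rejection -/

/-- The weight `1 / (1 + A)` of the `i`-th vector if it is rejected, where `A` is the number of
controls at the stopping time, and `0` otherwise. The supremum has at most one nonzero term. -/
noncomputable def weight {m K : ℕ} (q : ℝ) (R : ℕ → (Fin m → Fin K → ℝ) → Set (Fin K → ℝ))
    (i : Fin m) (x : Fin m → Fin K → ℝ) : ENNReal :=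
  ⨆ t, ⨆ (_ : StopsAt q coordP R t x ∧ coordP i x ∈ R t x),
    (1 + (numCtrl coordP (R t) x : ENNReal))⁻¹

theorem measurable_weight {m K : ℕ} {q : ℝ} {R : ℕ → (Fin m → Fin K → ℝ) → Set (Fin K → ℝ)}
    (hR : ∀ t, MeasurableSet {z : (Fin m → Fin K → ℝ) × (Fin K → ℝ) | z.2 ∈ R t z.1})
    (i : Fin m) : Measurable (weight q R i) := by
  classical
  refine Measurable.iSup fun t => ?_
  have hset : MeasurableSet {x | StopsAt q coordP R t x ∧ coordP i x ∈ R t x} :=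
    (measurableSet_stopsAt hR t).inter (measurableSet_mem_region (hR t) i)
  have hcast : Measurable (fun n : ℕ => (1 + (n : ENNReal))⁻¹) := measurable_from_top
  have heq : (fun x => ⨆ (_ : StopsAt q coordP R t x ∧ coordP i x ∈ R t x),
      (1 + (numCtrl coordP (R t) x : ENNReal))⁻¹) =
      {x | StopsAt q coordP R t x ∧ coordP i x ∈ R t x}.indicator
        fun x => (1 + (numCtrl coordP (R t) x : ENNReal))⁻¹ := by
    funext x
    by_cases h : StopsAt q coordP R t x ∧ coordP i x ∈ R t x <;> simp [Set.indicator, h]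
  rw [heq]
  exact (hcast.comp (measurable_numCtrl (hR t))).indicator hset

/-- For any data, the weights obtained by moving one vector at a time across one coordinate add up
to at most one: if `N` moves lead to a rejection, then they all stop with the same region, and
after each of these moves the other `N - 1` vectors are controls. -/
theorem sum_weight_flipAt_le_one {m K : ℕ} (G : ℕ → Set (Obs m K × (Fin K → ℝ))) (q : ℝ)
    (x : Fin m → Fin K → ℝ) :
    ∑ w : Fin m × Fin K, weight q (fun t => ruleRegion G (t + 1)) w.1 (flipAt w.1 w.2 x) ≤ 1 := by
  classical
  let R : ℕ → (Fin m → Fin K → ℝ) → Set (Fin K → ℝ) := fun t => ruleRegion G (t + 1)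
  let P : Finset (Fin m × Fin K) := Finset.univ.filter fun w =>
    ∃ t, StopsAt q coordP R t (flipAt w.1 w.2 x) ∧ flip w.2 (x w.1) ∈ R t (flipAt w.1 w.2 x)
  have hself : ∀ w : Fin m × Fin K,
      coordP w.1 (flipAt w.1 w.2 x) = flip w.2 (x w.1) := fun w => by simp [coordP, flipAt]
  have hout : ∀ w ∉ P, weight q R w.1 (flipAt w.1 w.2 x) = 0 := by
    intro w hw
    simp only [P, Finset.mem_filter, Finset.mem_univ, true_and, not_exists] at hw
    simp only [weight, ENNReal.iSup_eq_zero, hself]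
    exact fun t h => absurd h (hw t)
  have hin : ∀ w ∈ P, weight q R w.1 (flipAt w.1 w.2 x) ≤ (P.card : ENNReal)⁻¹ := by
    intro w hw
    refine iSup_le fun t => iSup_le fun ht => ?_
    rw [hself] at ht
    apply ENNReal.inv_le_inv.2
    have hsub : P.erase w ⊆ Finset.univ.filter fun w' : Fin m × Fin K =>
        flip w'.2 (flipAt w.1 w.2 x w'.1) ∈ R t (flipAt w.1 w.2 x) := by
      intro w' hw'
      rw [Finset.mem_erase] at hw'
      obtain ⟨hne, hmem⟩ := hw'
      simp only [P, Finset.mem_filter, Finset.mem_univ, true_and] at hmem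
      obtain ⟨s, hs, hsR⟩ := hmem
      have hi : w'.1 ≠ w.1 := by
        intro h
        apply hne
        refine Prod.ext h ?_
        refine eq_of_flip_mem_rejectionSide
          (ruleRegion_subset_rejectionSide G (s + 1) _ hsR) ?_
        rw [h]
        exact ruleRegion_subset_rejectionSide G (t + 1) _ ht.2
      obtain ⟨-, hreg⟩ := stopsAt_flipAt_eq hi hs hsR ht.1 ht.2
      simp only [Finset.mem_filter, Finset.mem_univ, true_and]
      have : flipAt w.1 w.2 x w'.1 = x w'.1 := by simp [flipAt, hi]
      rw [this]
      change _ ∈ ruleRegion G (t + 1) _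
      rw [← hreg]
      exact hsR
    have hcard := Finset.card_le_card hsub
    rw [← numCtrl_eq_card, Finset.card_erase_of_mem hw] at hcard
    have : P.card ≤ 1 + numCtrl coordP (R t) (flipAt w.1 w.2 x) := by omega
    exact_mod_cast this
  calc ∑ w : Fin m × Fin K, weight q R w.1 (flipAt w.1 w.2 x)
      = ∑ w ∈ P, weight q R w.1 (flipAt w.1 w.2 x) :=
        (Finset.sum_subset (Finset.subset_univ P) fun w _ hw => hout w hw).symm
    _ ≤ ∑ _w ∈ P, (P.card : ENNReal)⁻¹ := Finset.sum_le_sum hin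
    _ = P.card * (P.card : ENNReal)⁻¹ := by rw [Finset.sum_const, nsmul_eq_mul]
    _ ≤ 1 := ENNReal.mul_inv_le_one _

theorem fdp_nonneg {m : ℕ} (H D : Finset (Fin m)) : 0 ≤ fdp H D := by
  unfold fdp; positivity

theorem fdp_le_one {m : ℕ} (H D : Finset (Fin m)) : fdp H D ≤ 1 := by
  unfold fdp
  rw [div_le_one (by positivity)]
  exact le_max_of_le_left (by exact_mod_cast Finset.card_le_card Finset.inter_subset_left)

/-- At the stopping time the estimate `(1 + A) / (R ∨ 1)` is at most `q`, unless there are no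
rejections. -/
theorem ofReal_fdp_le_sum_weight {m K : ℕ} (H : Finset (Fin m)) {q : ℝ} (hq : 0 ≤ q)
    (R : ℕ → (Fin m → Fin K → ℝ) → Set (Fin K → ℝ)) (x : Fin m → Fin K → ℝ) :
    ENNReal.ofReal (fdp H (discoveries q coordP R x)) ≤
      ENNReal.ofReal q * ∑ i ∈ H, weight q R i x := by
  classical
  rcases (discoveries q coordP R x ∩ H).eq_empty_or_nonempty with hE | ⟨i₀, hi₀⟩
  · simp [fdp, hE]
  obtain ⟨t, ht, hi₀t⟩ : ∃ t, StopsAt q coordP R t x ∧ coordP i₀ x ∈ R t x := by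
    simpa [discoveries] using (Finset.mem_inter.1 hi₀).1
  have hmem : ∀ i, i ∈ discoveries q coordP R x ↔ coordP i x ∈ R t x := by
    intro i
    simp only [discoveries, Finset.mem_filter, Finset.mem_univ, true_and]
    exact ⟨fun ⟨s, hs, hsi⟩ => hs.unique ht ▸ hsi, fun h => ⟨t, ht, h⟩⟩
  have hcard : (discoveries q coordP R x).card = numRej coordP (R t) x := by
    have : discoveries q coordP R x = Finset.univ.filter fun i => coordP i x ∈ R t x := by
      ext i; simp [hmem]
    rw [this, Finset.card_filter, numRej]
  have hpos : 0 < numRej coordP (R t) x := by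
    rw [← hcard]
    exact Finset.card_pos.2 ⟨i₀, (Finset.mem_inter.1 hi₀).1⟩
  have hhat : fdpHat coordP (R t) x ≤ q := by
    by_contra hlt
    exact ht.1 ⟨not_le.1 hlt, hpos⟩
  set A := numCtrl coordP (R t) x with hA
  have hA1 : (0 : ℝ) < 1 + A := by positivity
  have hmax : (0 : ℝ) < max (numRej coordP (R t) x : ℝ) 1 := by positivity
  have hinv : (max (numRej coordP (R t) x : ℝ) 1)⁻¹ ≤ q * (1 + (A : ℝ))⁻¹ := by
    rw [← div_eq_mul_inv, le_div_iff₀ hA1, mul_comm, ← div_eq_mul_inv]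
    exact hhat
  have hw : ∀ i ∈ discoveries q coordP R x ∩ H, (1 + (A : ENNReal))⁻¹ ≤ weight q R i x := by
    intro i hi
    have hit := (hmem i).1 (Finset.mem_inter.1 hi).1
    exact le_iSup_of_le t (le_iSup_of_le ⟨ht, hit⟩ le_rfl)
  have hofReal : ENNReal.ofReal ((1 + (A : ℝ))⁻¹) = (1 + (A : ENNReal))⁻¹ := by
    rw [ENNReal.ofReal_inv_of_pos hA1, ENNReal.ofReal_add zero_le_one (Nat.cast_nonneg _),
      ENNReal.ofReal_one, ENNReal.ofReal_natCast]
  calc ENNReal.ofReal (fdp H (discoveries q coordP R x))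
      ≤ ENNReal.ofReal (q * ((discoveries q coordP R x ∩ H).card * (1 + (A : ℝ))⁻¹)) := by
        apply ENNReal.ofReal_le_ofReal
        rw [fdp, hcard, div_eq_mul_inv]
        calc _ ≤ ((discoveries q coordP R x ∩ H).card : ℝ) * (q * (1 + (A : ℝ))⁻¹) := by gcongr
          _ = _ := by ring
    _ = ENNReal.ofReal q * ∑ _i ∈ discoveries q coordP R x ∩ H, (1 + (A : ENNReal))⁻¹ := by
        rw [ENNReal.ofReal_mul hq, ENNReal.ofReal_mul (Nat.cast_nonneg _), hofReal,
          ENNReal.ofReal_natCast, Finset.sum_const, nsmul_eq_mul]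
    _ ≤ ENNReal.ofReal q * ∑ i ∈ H, weight q R i x := by
        gcongr
        exact (Finset.sum_le_sum hw).trans
          (Finset.sum_le_sum_of_subset Finset.inter_subset_right)

/-! ### False discovery rate control -/

theorem discoveries_coordP {Ω : Type*} {m K : ℕ} {q : ℝ} {p : Fin m → Ω → Fin K → ℝ}
    {R : ℕ → Ω → Set (Fin K → ℝ)} {R' : ℕ → (Fin m → Fin K → ℝ) → Set (Fin K → ℝ)} {ω : Ω}
    (h : ∀ t, R t ω = R' t (fun i => p i ω)) :
    discoveries q p R ω = discoveries q coordP R' (fun i => p i ω) := by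
  have hc : ∀ t, Continues q p R t ω ↔ Continues q coordP R' t (fun i => p i ω) := by
    intro t
    unfold Continues fdpHat numCtrl numRej
    rw [h]
    rfl
  ext i
  simp only [discoveries, Finset.mem_filter, Finset.mem_univ, true_and]
  simp only [StopsAt, hc, coordP, h]

theorem mul_sum_lintegral_weight_le_one {Ω : Type*} [MeasurableSpace Ω] {μ : Measure Ω}
    [IsProbabilityMeasure μ] {m K κ : ℕ} {θ : Fin m → Fin K → Fin 2}
    {p : Fin m → Ω → Fin K → ℝ} (hp : ∀ i, Measurable (p i))
    (hind : ∀ i ∈ partialNull θ κ,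
      IndepFun (p i) (fun ω => Function.update (fun j => p j ω) i 0) μ)
    (hmir : ∀ i ∈ partialNull θ κ, CondMirrorConservative (θ i) (μ.map (p i)))
    {G : ℕ → Set (Obs m K × (Fin K → ℝ))} (hG : ∀ t, MeasurableSet (G t)) (q : ℝ) :
    (κ : ENNReal) * ∑ i ∈ partialNull θ κ,
      ∫⁻ ω, weight q (fun t => ruleRegion G (t + 1)) i (fun j => p j ω) ∂μ ≤ 1 := by
  set R : ℕ → (Fin m → Fin K → ℝ) → Set (Fin K → ℝ) := fun t => ruleRegion G (t + 1) with hR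
  have hwm : ∀ i, Measurable (weight q R i) :=
    measurable_weight fun t => measurableSet_ruleRegion hG (t + 1)
  have hw0 : ∀ i x, x i ∉ rejectionSide K → weight q R i x = 0 := by
    intro i x hx
    simp only [weight, ENNReal.iSup_eq_zero]
    exact fun t h => absurd (ruleRegion_subset_rejectionSide G (t + 1) x h.2) hx
  have hpm : Measurable fun ω j => p j ω := measurable_pi_lambda _ hp
  have hflip : ∀ (i : Fin m) (k : Fin K), Measurable (flipAt i k) := by
    intro i k
    refine measurable_pi_lambda _ fun j => ?_
    by_cases h : j = i
    · subst h
      simpa [flipAt, Function.comp_def] using (measurable_flip k).comp (measurable_pi_apply j)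
    · simpa [flipAt, h] using measurable_pi_apply j
  calc (κ : ENNReal) * ∑ i ∈ partialNull θ κ, ∫⁻ ω, weight q R i (fun j => p j ω) ∂μ
      = ∑ i ∈ partialNull θ κ, (κ : ENNReal) * ∫⁻ ω, weight q R i (fun j => p j ω) ∂μ :=
        Finset.mul_sum _ _ _
    _ ≤ ∑ i ∈ partialNull θ κ, ∑ _k ∈ nullComponents (θ i),
          ∫⁻ ω, weight q R i (fun j => p j ω) ∂μ := by
        refine Finset.sum_le_sum fun i hi => ?_
        rw [Finset.sum_const, nsmul_eq_mul]
        gcongr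
        simpa [partialNull] using hi
    _ ≤ ∑ i ∈ partialNull θ κ, ∑ k ∈ nullComponents (θ i),
          ∫⁻ ω, weight q R i (flipAt i k (fun j => p j ω)) ∂μ := by
        refine Finset.sum_le_sum fun i hi => Finset.sum_le_sum fun k hk => ?_
        exact lintegral_le_lintegral_flipAt hp (hind i hi)
          (hmir i hi k (by simpa [nullComponents] using hk)) (hwm i) (hw0 i)
    _ ≤ ∑ i, ∑ k, ∫⁻ ω, weight q R i (flipAt i k (fun j => p j ω)) ∂μ :=
        (Finset.sum_le_sum fun i _ => Finset.sum_le_sum_of_subset (Finset.subset_univ _)).trans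
          (Finset.sum_le_sum_of_subset (Finset.subset_univ _))
    _ = ∫⁻ ω, ∑ w : Fin m × Fin K, weight q R w.1 (flipAt w.1 w.2 (fun j => p j ω)) ∂μ := by
        rw [lintegral_finsetSum _ fun w _ => (hwm w.1).comp ((hflip w.1 w.2).comp hpm),
          Fintype.sum_prod_type]
    _ ≤ ∫⁻ _, 1 ∂μ := lintegral_mono fun ω => sum_weight_flipAt_le_one G q _
    _ = 1 := by simp

end JointMirror

theorem theorem1 {Ω : Type*} [MeasurableSpace Ω] (μ : MeasureTheory.Measure Ω)
    [MeasureTheory.IsProbabilityMeasure μ] (m K : ℕ) (κ : ℕ) (hκ : 1 ≤ κ) (hκK : κ ≤ K)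
    (θ : Fin m → Fin K → Fin 2)
    (p : Fin m → Ω → Fin K → ℝ)
    (hp_meas : ∀ i, Measurable (p i))
    (hp_range : ∀ i ω k, p i ω k ∈ Set.Icc (0 : ℝ) 1)
    -- the null p-value vectors are independent of each other
    (h_null_indep : ProbabilityTheory.iIndepFun
      (fun i : {i : Fin m // i ∈ JointMirror.partialNull θ κ} => p i) μ)
    -- the null p-value vectors are independent of the non-null ones
    (h_nonnull_indep : ProbabilityTheory.IndepFun
      (fun ω (i : {i : Fin m // i ∈ JointMirror.partialNull θ κ}) => p i ω)
      (fun ω (i : {i : Fin m // i ∉ JointMirror.partialNull θ κ}) => p i ω) μ)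
    (h_mirror : ∀ i ∈ JointMirror.partialNull θ κ,
      JointMirror.CondMirrorConservative (θ i) (μ.map (p i)))
    (q : ℝ) (hq0 : 0 < q) (hq1 : q < 1)
    (R : ℕ → Ω → Set (Fin K → ℝ)) (hR : JointMirror.IsJMRegions p R) :
    -- the false discovery proportion has an expectation, and FDR control holds
    MeasureTheory.Integrable
        (fun ω => JointMirror.fdp (JointMirror.partialNull θ κ)
          (JointMirror.discoveries q p R ω)) μ ∧
      JointMirror.fdr μ (JointMirror.partialNull θ κ) (JointMirror.discoveries q p R) ≤ q / κ ∧
      κ * JointMirror.fdr μ (JointMirror.partialNull θ κ) (JointMirror.discoveries q p R) ≤ q ∧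
      (κ = 1 →
        JointMirror.fdr μ (JointMirror.compositeNull θ) (JointMirror.discoveries q p R) ≤ q) := by
  obtain ⟨G, hG, hRG⟩ := hR.exists_ruleRegion
  have hκ0 : (0 : ℝ) < κ := by exact_mod_cast hκ
  have hm : Measurable fun ω => JointMirror.fdp (JointMirror.partialNull θ κ)
      (JointMirror.discoveries q p R ω) := by
    have hD : ∀ ω, JointMirror.discoveries q p R ω =
        JointMirror.discoveries q JointMirror.coordP
          (fun t => JointMirror.ruleRegion G (t + 1)) (fun i => p i ω) :=
      fun ω => JointMirror.discoveries_coordP fun t => hRG t ω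
    simp only [hD]
    exact (JointMirror.measurable_fdp_discoveries _ fun t =>
      JointMirror.measurableSet_ruleRegion hG (t + 1)).comp (measurable_pi_lambda _ hp_meas)
  have hint : MeasureTheory.Integrable (fun ω => JointMirror.fdp (JointMirror.partialNull θ κ)
      (JointMirror.discoveries q p R ω)) μ := by
    refine MeasureTheory.Integrable.of_bound hm.aestronglyMeasurable 1 (.of_forall fun ω => ?_)
    rw [Real.norm_of_nonneg (JointMirror.fdp_nonneg _ _)]
    exact JointMirror.fdp_le_one _ _
  have hw := JointMirror.mul_sum_lintegral_weight_le_one hp_meas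
    (fun i hi => JointMirror.indepFun_update hp_meas h_null_indep h_nonnull_indep hi)
    h_mirror hG q
  have hmain : κ * JointMirror.fdr μ (JointMirror.partialNull θ κ)
      (JointMirror.discoveries q p R) ≤ q := by
    have hle : (κ : ENNReal) * ∫⁻ ω, ENNReal.ofReal (JointMirror.fdp (JointMirror.partialNull θ κ)
        (JointMirror.discoveries q p R ω)) ∂μ ≤ ENNReal.ofReal q := by
      calc _ ≤ (κ : ENNReal) * ∫⁻ ω, ENNReal.ofReal q * ∑ i ∈ JointMirror.partialNull θ κ,
            JointMirror.weight q (fun t => JointMirror.ruleRegion G (t + 1)) i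
              (fun j => p j ω) ∂μ := by
            gcongr with ω
            rw [JointMirror.discoveries_coordP fun t => hRG t ω]
            exact JointMirror.ofReal_fdp_le_sum_weight _ hq0.le _ _
        _ = ENNReal.ofReal q * (κ * ∑ i ∈ JointMirror.partialNull θ κ,
            ∫⁻ ω, JointMirror.weight q (fun t => JointMirror.ruleRegion G (t + 1)) i
              (fun j => p j ω) ∂μ) := by
            have hwm : ∀ i, Measurable fun ω => JointMirror.weight q
                (fun t => JointMirror.ruleRegion G (t + 1)) i (fun j => p j ω) := fun i =>
              (JointMirror.measurable_weight (fun t =>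
                JointMirror.measurableSet_ruleRegion hG (t + 1)) i).comp
                (measurable_pi_lambda _ hp_meas)
            rw [MeasureTheory.lintegral_const_mul _ (Finset.measurable_sum _ fun i _ => hwm i),
              MeasureTheory.lintegral_finsetSum _ fun i _ => hwm i, mul_left_comm]
        _ ≤ ENNReal.ofReal q * 1 := by gcongr
        _ = _ := mul_one _
    rw [JointMirror.fdr, MeasureTheory.integral_eq_lintegral_of_nonneg_ae
      (.of_forall fun ω => JointMirror.fdp_nonneg _ _) hm.aestronglyMeasurable,
      ← ENNReal.toReal_natCast, ← ENNReal.toReal_mul]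
    exact (ENNReal.toReal_mono ENNReal.ofReal_ne_top hle).trans_eq (ENNReal.toReal_ofReal hq0.le)
  refine ⟨hint, (le_div_iff₀' hκ0).2 hmain, hmain, fun h1 => ?_⟩
  have hnull : JointMirror.compositeNull θ = JointMirror.partialNull θ κ := by
    ext i
    simp [JointMirror.compositeNull, JointMirror.partialNull, JointMirror.nullComponents, h1,
      Finset.one_le_card, Finset.filter_nonempty_iff]
  rw [hnull]
  simpa [h1] using hmain
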